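/- For a topological space $X$, let $d(X)$ denote its density, that is, the minimal cardinality of a dense subset of $X$. The local density $\mathrm{ld}(x)$ of a point $x\in X$ is the minimal density of a neighborhood of $x$, and the local density of $X$ is $\mathrm{ld}(X)=\sup_{x\in X}\mathrm{ld}(x)$; it is realized if $\mathrm{ld}(x)=\mathrm{ld}(X)$ for some point $x\in X$. Let $K(X)$ be the family of compact subsets of $X$, ordered by inclusion. For a cardinal $\kappa$, let $\mathrm{fin}(\kappa)$ be the family of finite subsets of $\kappa$, and order the set $\mathrm{fin}(\kappa)^{\mathbb N}$ of all functions $f\colon\mathbb N\to\mathrm{fin}(\kappa)$ by $f\le g$ if and only if $f(n)\subseteq g(n)$ for all $n\in\mathbb N$. For partially ordered sets $P$ and $Q$, write $P\preceq Q$ if there is a monotone map from $P$ to $Q$ whose image is cofinal in $Q$, and $P\approx Q$ if $P\preceq Q$ and $Q\preceq P$. Let $X$ be a complete metric space that is not locally compact, with $d(X)=\mathrm{ld}(X)$. If the local density of $X$ is realized, or the cardinal $\mathrm{ld}(X)$ has uncountable cofinality, then $$K(X)\approx \mathrm{fin}(d(X))^{\mathbb N}.$$ -/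

import Mathlib

open Cardinal Topology

namespace CofinalStructure

universe u v

/-- `P ⪯ Q`: there is a monotone map `ψ : P → Q` whose image is cofinal in `Q`. -/
def CofinallyBelow (P : Type u) (Q : Type v) [PartialOrder P] [PartialOrder Q] : Prop :=
  ∃ ψ : P → Q, Monotone ψ ∧ IsCofinal (Set.range ψ)

/-- Cofinal equivalence `P ≈ Q`: both `P ⪯ Q` and `Q ⪯ P`. -/
def CofinallyEquiv (P : Type u) (Q : Type v) [PartialOrder P] [PartialOrder Q] : Prop :=
  CofinallyBelow P Q ∧ CofinallyBelow Q P

/-- The density of a topological space: the minimal cardinality of a dense subset. -/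
noncomputable def density (X : Type u) [TopologicalSpace X] : Cardinal.{u} :=
  sInf {κ : Cardinal.{u} | ∃ D : Set X, Dense D ∧ #D = κ}

/-- The local density of a point: the minimal density of a neighborhood of the point,
where a neighborhood carries the subspace topology. -/
noncomputable def localDensityAt {X : Type u} [TopologicalSpace X] (x : X) : Cardinal.{u} :=
  sInf {κ : Cardinal.{u} | ∃ U ∈ 𝓝 x, density U = κ}

/-- The local density of a space: the supremum of the local densities of its points
(the family is indexed by `X : Type u`, hence bounded in `Cardinal.{u}`). -/
noncomputable def localDensity (X : Type u) [TopologicalSpace X] : Cardinal.{u} :=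
  ⨆ x : X, localDensityAt x

/-- The local density of the space is attained at some point. -/
def LocalDensityRealized (X : Type u) [TopologicalSpace X] : Prop :=
  ∃ x : X, localDensityAt x = localDensity X

/-- `fin(κ)`: the finite subsets of the cardinal `κ` (the initial ordinal of cardinality `κ`),
ordered by inclusion. -/
abbrev FinSubsets (κ : Cardinal.{u}) : Type u :=
  Finset κ.ord.ToType

end CofinalStructure

namespace CofinalStructure

open Set Metric TopologicalSpace

section Separated

variable {X : Type u} [MetricSpace X]

/-! Given a dense family, `f` is sent to the intersection over `n` of the closed `1/(n+1)`-balls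
about the points indexed by `f n`; completeness makes it compact
(`finsets_cofinallyBelow_compacts`). Conversely, indices are coded by pairs of points accumulating
at some `y`, and a compact set is sent to the indices it codes at each scale
(`compacts_cofinallyBelow_of_codedNear`). If the local density is uncountable and possibly not
realized, a uniformly separated set of points `y` replaces a single one, and uncountable cofinality
lets one `y` serve a whole sequence `f`. -/

lemma exists_maximal_separated (U : Set X) {ε : ℝ} (hε : 0 < ε) :
    ∃ S ⊆ U, S.Pairwise (fun a b => ε ≤ dist a b) ∧ ∀ x ∈ U, ∃ y ∈ S, dist x y < ε := by
  obtain ⟨S, hS⟩ := zorn_subset {S : Set X | S ⊆ U ∧ S.Pairwise (fun a b => ε ≤ dist a b)} (by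
    intro c hc hchain
    refine ⟨⋃₀ c, ⟨sUnion_subset fun s hs => (hc hs).1, ?_⟩, fun s hs => subset_sUnion_of_mem hs⟩
    exact (pairwise_sUnion hchain.directedOn).2 fun s hs => (hc hs).2)
  refine ⟨S, hS.prop.1, hS.prop.2, fun x hx => ?_⟩
  by_contra! h
  have hmem : insert x S ⊆ S := hS.le_of_ge
    ⟨insert_subset hx hS.prop.1, hS.prop.2.insert fun y hy _ => ⟨h y hy, dist_comm x y ▸ h y hy⟩⟩
    (subset_insert x S)
  have := h x (hmem (mem_insert x S))
  rw [dist_self] at this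
  exact this.not_gt hε

lemma finite_of_separated_of_cover {S t : Set X} {r : ℝ} (ht : t.Finite)
    (hcover : S ⊆ ⋃ c ∈ t, ball c r) (hS : S.Pairwise (fun a b => 2 * r ≤ dist a b)) :
    S.Finite := by
  have : S = ⋃ c ∈ t, S ∩ ball c r := by
    rw [← inter_iUnion₂, inter_eq_left.2 hcover]
  rw [this]
  refine ht.biUnion fun c _ => Subsingleton.finite fun a ha b hb => ?_
  by_contra hab
  have h₁ := hS ha.1 hb.1 hab
  have h₂ := dist_triangle_right a b c
  have h₃ := mem_ball.1 ha.2
  have h₄ := mem_ball.1 hb.2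
  linarith

lemma finite_of_separated_of_isCompact {S K : Set X} {ε : ℝ} (hε : 0 < ε)
    (hS : S.Pairwise (fun a b => ε ≤ dist a b)) (hK : IsCompact K) : (S ∩ K).Finite := by
  obtain ⟨t, ht, hcover⟩ := totallyBounded_iff.1 hK.totallyBounded (ε / 2) (half_pos hε)
  refine finite_of_separated_of_cover ht (inter_subset_right.trans hcover) ?_
  exact (hS.mono inter_subset_left).imp fun a b h => by linarith

end Separated

/-! ### Density and local density -/

section Density

variable {X : Type u} [TopologicalSpace X]

lemma density_le {D : Set X} (hD : Dense D) : density X ≤ #D :=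
  csInf_le' ⟨D, hD, rfl⟩

lemma exists_dense_mk_eq_density (X : Type u) [TopologicalSpace X] :
    ∃ D : Set X, Dense D ∧ #D = density X :=
  csInf_mem (s := {κ : Cardinal.{u} | ∃ D : Set X, Dense D ∧ #D = κ}) ⟨_, univ, dense_univ, rfl⟩

lemma localDensityAt_le {x : X} {U : Set X} (hU : U ∈ 𝓝 x) : localDensityAt x ≤ density U :=
  csInf_le' ⟨U, hU, rfl⟩

lemma exists_nhds_density_eq (x : X) : ∃ U ∈ 𝓝 x, density U = localDensityAt x :=
  csInf_mem (s := {κ : Cardinal.{u} | ∃ U ∈ 𝓝 x, density U = κ}) ⟨_, univ, Filter.univ_mem, rfl⟩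

lemma localDensityAt_le_localDensity (x : X) : localDensityAt x ≤ localDensity X :=
  le_ciSup Cardinal.bddAbove_of_small x

lemma density_le_mk_of_subset_closure {U S : Set X} (hSU : S ⊆ U) (hU : U ⊆ closure S) :
    density U ≤ #S := by
  have hdense : Dense (Subtype.val ⁻¹' S : Set U) := by
    rw [dense_iff_closure_eq, eq_univ_iff_forall]
    intro x
    rw [Topology.IsInducing.subtypeVal.closure_eq_preimage_closure_image,
      Subtype.image_preimage_coe, inter_eq_right.2 hSU]
    exact hU x.2
  refine (density_le hdense).trans ?_
  exact Cardinal.mk_preimage_of_injective _ _ Subtype.val_injective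

lemma aleph0_le_density_of_not_isCompact [T1Space X] {U : Set X} (hU : ¬ IsCompact U) :
    ℵ₀ ≤ density U := by
  by_contra! h
  obtain ⟨D, hD, hcard⟩ := exists_dense_mk_eq_density U
  have hfin : D.Finite := by
    rw [← hcard] at h
    exact Cardinal.lt_aleph0_iff_set_finite.1 h
  have huniv : D = Set.univ := by rw [← hfin.isClosed.closure_eq, hD.closure_eq]
  rw [huniv, finite_univ_iff] at hfin
  exact hU (toFinite U).isCompact

lemma density_le_aleph0_of_isCompact {X : Type u} [MetricSpace X] {U : Set X} (hU : IsCompact U) :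
    density U ≤ ℵ₀ := by
  have : CompactSpace U := isCompact_iff_compactSpace.1 hU
  obtain ⟨D, hDc, hD⟩ := exists_countable_dense U
  exact (density_le hD).trans hDc.le_aleph0

lemma eventually_localDensityAt_le (x : X) :
    ∀ᶠ y in 𝓝 x, localDensityAt y ≤ localDensityAt x := by
  obtain ⟨U, hU, hUd⟩ := exists_nhds_density_eq x
  filter_upwards [eventually_mem_nhds_iff.2 hU] with y hy
  exact hUd ▸ localDensityAt_le hy

end Density

/-! ### Coding indices by pairs of points -/

section Coding

variable {X : Type u} [MetricSpace X] {T : Type u}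

/-- Arbitrarily close to `x` the elements of `A` can be coded by pairs of points in such a way
that a compact set contains the codes of only finitely many elements. -/
def CodedNear (x : X) (A : Set T) : Prop :=
  ∀ δ > 0, ∃ a b : T → X, (∀ t ∈ A, a t ∈ ball x δ ∧ b t ∈ ball x δ) ∧
    ∀ K, IsCompact K → {t | t ∈ A ∧ a t ∈ K ∧ b t ∈ K}.Finite

/-- The maximal `1/(k+1)`-separated sets have dense union in the ball, so their points can label
`A`. A compact set meets each level in a finite set but may meet infinitely many levels; the second
point of the code names the level and excludes this. -/
lemma codedNear_of_mk_le_density [CompleteSpace X] {x : X} {A : Set T}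
    (hx : ∀ U ∈ 𝓝 x, ¬ IsCompact U) (hA : ∀ U ∈ 𝓝 x, #A ≤ density U) : CodedNear x A := by
  intro δ hδ
  have hpos : ∀ k : ℕ, (0 : ℝ) < 1 / (k + 1) := fun k => Nat.one_div_pos_of_nat
  choose S hSU hSsep hScover using fun k : ℕ => exists_maximal_separated (ball x δ) (hpos k)
  have hcard : #A ≤ #(⋃ k, S k) := by
    refine (hA _ (ball_mem_nhds x hδ)).trans ?_
    refine density_le_mk_of_subset_closure (iUnion_subset hSU) fun y hy => ?_
    rw [Metric.mem_closure_iff]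
    intro ε hε
    obtain ⟨k, hk⟩ := exists_nat_one_div_lt hε
    obtain ⟨z, hz, hyz⟩ := hScover k y hy
    exact ⟨z, mem_iUnion_of_mem k hz, hyz.trans hk⟩
  have hinf : ∃ k, (S k).Infinite := by
    by_contra! h
    have htb : TotallyBounded (ball x δ) := by
      refine totallyBounded_iff.2 fun ε hε => ?_
      obtain ⟨k, hk⟩ := exists_nat_one_div_lt hε
      refine ⟨S k, h k, fun y hy => ?_⟩
      obtain ⟨z, hz, hyz⟩ := hScover k y hy
      exact mem_biUnion hz (hyz.trans hk)
    refine hx (closedBall x (δ / 2)) (closedBall_mem_nhds x (half_pos hδ)) ?_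
    exact (htb.subset (closedBall_subset_ball (half_lt_self hδ))).isCompact_of_isClosed
      isClosed_closedBall
  -- The infinite separated set `S m` serves as a copy of `ℕ` for naming levels.
  obtain ⟨m, hm⟩ := hinf
  let e : ℕ ↪ S m := hm.natEmbedding
  obtain ⟨j⟩ := Cardinal.le_def _ _ |>.1 hcard
  choose ν hν using fun t : A => mem_iUnion.1 (j t).2
  let a : A → X := fun t => e (ν t)
  let b : A → X := fun t => j t
  refine ⟨Function.extend Subtype.val a fun _ => x, Function.extend Subtype.val b fun _ => x,
    fun t ht => ?_, fun K hK => ?_⟩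
  · rw [Subtype.val_injective.extend_apply a _ ⟨t, ht⟩,
      Subtype.val_injective.extend_apply b _ ⟨t, ht⟩]
    exact ⟨hSU _ (e (ν ⟨t, ht⟩)).2, hSU _ (hν ⟨t, ht⟩)⟩
  · have hN : {n | (e n : X) ∈ K}.Finite := by
      have := finite_of_separated_of_isCompact (hpos m) (hSsep m) hK
      refine (this.preimage (f := fun n => (e n : X))
        (Subtype.val_injective.comp e.injective).injOn).subset fun n hn => ⟨(e n).2, hn⟩
    have hfib : ∀ n, {t : A | ν t = n ∧ b t ∈ K}.Finite := fun n => by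
      have := finite_of_separated_of_isCompact (hpos n) (hSsep n) hK
      refine (this.preimage (f := b) (Subtype.val_injective.comp j.injective).injOn).subset ?_
      rintro t ⟨rfl, ht⟩
      exact ⟨hν t, ht⟩
    refine ((hN.biUnion fun n _ => hfib n).image Subtype.val).subset ?_
    rintro t ⟨ht, hat, hbt⟩
    rw [Subtype.val_injective.extend_apply a _ ⟨t, ht⟩] at hat
    rw [Subtype.val_injective.extend_apply b _ ⟨t, ht⟩] at hbt
    exact ⟨⟨t, ht⟩, mem_biUnion (x := ν ⟨t, ht⟩) hat ⟨rfl, hbt⟩, rfl⟩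

lemma isCompact_insert_iUnion {x : X} {F : ℕ → Set X} (hfin : ∀ n, (F n).Finite)
    (hF : ∀ n : ℕ, F n ⊆ ball x (1 / (n + 1))) : IsCompact (insert x (⋃ n, F n)) := by
  have hrange : ⋃ n, F n = range fun i : Σ n, F n => (i.2 : X) := by
    ext y
    simp
  rw [hrange]
  refine Filter.Tendsto.isCompact_insert_range_of_cofinite (Metric.tendsto_nhds.2 fun ε hε => ?_)
  obtain ⟨N, hN⟩ := exists_nat_one_div_lt hε
  have : ∀ n, Finite (F n) := fun n => (hfin n).to_subtype
  refine ((finite_lt_nat N).biUnion fun n _ =>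
    finite_range (Sigma.mk (β := fun n => F n) n)).subset ?_
  rintro ⟨n, y⟩ hy
  refine mem_biUnion (show n < N from ?_) (mem_range_self y)
  by_contra! h
  exact hy ((mem_ball.1 (hF n y.2)).trans_le ((Nat.one_div_le_one_div h).trans hN.le))

lemma compacts_cofinallyBelow_of_codedNear {R : Set X} {A : X → Set T} {δ : ℝ} (hδ : 0 < δ)
    (hR : R.Pairwise (fun y z => 4 * δ ≤ dist y z)) (hA : ∀ y ∈ R, CodedNear y (A y))
    (hcover : ∀ f : ℕ → Finset T, ∃ y ∈ R, ∀ n, ↑(f n) ⊆ A y) :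
    CofinallyBelow (Compacts X) (ℕ → Finset T) := by
  -- The bound `δ` lets a compact set meet the codes of only finitely many `y`; the bound `1/(n+1)`
  -- makes codes of finite sets converge to `y`.
  have hr : ∀ n : ℕ, 0 < min δ (1 / (n + 1)) := fun n => lt_min hδ Nat.one_div_pos_of_nat
  choose! a b hab hfin using fun y (hy : y ∈ R) (n : ℕ) => hA y hy _ (hr n)
  have hψ : ∀ (K : Compacts X) (n : ℕ),
      {t | ∃ y ∈ R, t ∈ A y ∧ a y n t ∈ K ∧ b y n t ∈ K}.Finite := by
    intro K n
    obtain ⟨s, hs, hKs⟩ := totallyBounded_iff.1 K.isCompact.totallyBounded δ hδ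
    have hRK : {y | y ∈ R ∧ (ball y δ ∩ K).Nonempty}.Finite := by
      refine finite_of_separated_of_cover (r := 2 * δ) hs ?_
        ((hR.mono (sep_subset _ _)).imp fun y z h => by linarith)
      rintro y ⟨_, z, hzy, hzK⟩
      obtain ⟨c, hc, hzc⟩ := mem_iUnion₂.1 (hKs hzK)
      refine mem_biUnion hc ?_
      have := dist_triangle_left y c z
      rw [mem_ball] at *
      linarith
    refine (hRK.biUnion fun y hy => hfin y hy.1 n K K.isCompact).subset ?_
    rintro t ⟨y, hy, ht, hat, hbt⟩
    refine mem_biUnion ⟨hy, a y n t, ?_, hat⟩ ⟨ht, hat, hbt⟩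
    exact ball_subset_ball (min_le_left _ _) (hab y hy n t ht).1
  refine ⟨fun K n => (hψ K n).toFinset, fun K L hKL n => ?_, fun f => ?_⟩
  · refine Finite.toFinset_subset_toFinset.2 ?_
    rintro t ⟨y, hy, ht, hat, hbt⟩
    exact ⟨y, hy, ht, hKL hat, hKL hbt⟩
  · obtain ⟨y, hy, hfy⟩ := hcover f
    have hcompact : IsCompact (insert y (⋃ n, a y n '' f n ∪ b y n '' f n)) := by
      refine isCompact_insert_iUnion
        (fun n => ((f n).finite_toSet.image _).union ((f n).finite_toSet.image _)) fun n => ?_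
      rintro _ (⟨t, ht, rfl⟩ | ⟨t, ht, rfl⟩)
      · exact ball_subset_ball (min_le_right _ _) (hab y hy n t (hfy n ht)).1
      · exact ball_subset_ball (min_le_right _ _) (hab y hy n t (hfy n ht)).2
    refine ⟨_, ⟨⟨_, hcompact⟩, rfl⟩, fun n t ht => ?_⟩
    refine (hψ _ n).mem_toFinset.2 ⟨y, hy, hfy n ht, ?_, ?_⟩
    · exact mem_insert_of_mem _ (mem_iUnion_of_mem n (.inl (mem_image_of_mem _ ht)))
    · exact mem_insert_of_mem _ (mem_iUnion_of_mem n (.inr (mem_image_of_mem _ ht)))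

lemma compacts_cofinallyBelow_of_codedNear_univ {x : X} (hx : CodedNear x (univ : Set T)) :
    CofinallyBelow (Compacts X) (ℕ → Finset T) :=
  compacts_cofinallyBelow_of_codedNear (R := {x}) (A := fun _ => univ) one_pos
    (pairwise_singleton _ _) (by simpa using hx) fun _ => ⟨x, rfl, fun _ => subset_univ _⟩

end Coding

/-! ### The two cofinal maps -/

section Cofinality

variable {X : Type u} [MetricSpace X]

lemma finsets_cofinallyBelow_compacts [CompleteSpace X] {T : Type*} {d : T → X}
    (hd : DenseRange d) : CofinallyBelow (ℕ → Finset T) (Compacts X) := by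
  let C : (ℕ → Finset T) → Set X := fun f => ⋂ n : ℕ, ⋃ t ∈ f n, closedBall (d t) (1 / (n + 1))
  have hC : ∀ f, IsCompact (C f) := fun f => by
    refine TotallyBounded.isCompact_of_isClosed (totallyBounded_iff.2 fun ε hε => ?_)
      (isClosed_iInter fun n => (f n).finite_toSet.isClosed_biUnion fun t _ => isClosed_closedBall)
    obtain ⟨n, hn⟩ := exists_nat_one_div_lt hε
    refine ⟨d '' f n, (f n).finite_toSet.image d, fun x hx => ?_⟩
    obtain ⟨t, ht, hxt⟩ := mem_iUnion₂.1 (mem_iInter.1 hx n)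
    exact mem_biUnion (mem_image_of_mem d ht) (closedBall_subset_ball hn hxt)
  refine ⟨fun f => ⟨C f, hC f⟩, fun f g hfg => ?_, fun K => ?_⟩
  · exact iInter_mono fun n => biUnion_subset_biUnion_left (hfg n)
  · have : ∀ n : ℕ, ∃ s : Finset T, (K : Set X) ⊆ ⋃ t ∈ s, closedBall (d t) (1 / (n + 1)) := by
      intro n
      obtain ⟨s, hs⟩ := K.isCompact.elim_finite_subcover (fun t => ball (d t) (1 / (n + 1)))
        (fun t => isOpen_ball) fun x _ => by
          obtain ⟨t, ht⟩ := hd.exists_dist_lt x (Nat.one_div_pos_of_nat (n := n))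
          exact mem_iUnion_of_mem t ht
      exact ⟨s, hs.trans (iUnion₂_mono fun t _ => ball_subset_closedBall)⟩
    choose f hf using this
    exact ⟨_, ⟨f, rfl⟩, subset_iInter hf⟩

/-- Near each point of a suitable set with unbounded local density, the local density does not
exceed its value at the point, at a scale that is uniform over the set. -/
lemma exists_uniform_unbounded_localDensityAt
    (hcof : ℵ₀ < (localDensity X).ord.cof) :
    ∃ ε > 0, ∃ Y : Set X,
      (∀ x ∈ Y, ∀ y, dist y x < ε → localDensityAt y ≤ localDensityAt x) ∧
      ∀ c < localDensity X, ∃ x ∈ Y, c < localDensityAt x := by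
  let Y : ℕ → Set X := fun n =>
    {x | ∀ y, dist y x < 1 / ((n : ℝ) + 1) → localDensityAt y ≤ localDensityAt x}
  have hY : ∀ x, ∃ n, x ∈ Y n := fun x => by
    obtain ⟨ε, hε, h⟩ := Metric.eventually_nhds_iff.1 (eventually_localDensityAt_le x)
    obtain ⟨n, hn⟩ := exists_nat_one_div_lt hε
    exact ⟨n, fun y hy => h (hy.trans hn)⟩
  suffices ∃ n, ∀ c < localDensity X, ∃ x ∈ Y n, c < localDensityAt x by
    obtain ⟨n, hn⟩ := this
    exact ⟨_, Nat.one_div_pos_of_nat, Y n, fun x hx => hx, hn⟩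
  by_contra! h
  choose c hc hle using h
  -- Countably many bounds `c n` cannot reach a cardinal of uncountable cofinality.
  have hsup : ⨆ n, c n < localDensity X :=
    Cardinal.lift_iSup_lt_of_lt_cof_ord (by simpa using hcof) hc
  refine hsup.not_ge (ciSup_le' fun x => ?_)
  obtain ⟨n, hn⟩ := hY x
  exact (hle n x hn).trans (le_ciSup (Cardinal.bddAbove_of_small) n)

lemma compacts_cofinallyBelow_of_lt_cof [CompleteSpace X]
    (hcof : ℵ₀ < (localDensity X).ord.cof) :
    CofinallyBelow (Compacts X) (ℕ → FinSubsets (localDensity X)) := by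
  obtain ⟨ε, hε, Y, hYloc, hY⟩ := exists_uniform_unbounded_localDensityAt hcof
  have hκ : ℵ₀ < localDensity X := hcof.trans_le (by simpa using (localDensity X).ord.cof_le_card)
  -- Uncountable local density rules out compact neighborhoods.
  let Z : Set X := {x ∈ Y | ℵ₀ < localDensityAt x}
  -- One point per value of the local density: points of `Y` closer than `ε` have equal values, so
  -- `R` is `ε`-separated.
  obtain ⟨R, hRZ, hR⟩ := (surjOn_image localDensityAt Z).exists_bijOn_subset
  let A : X → Set (localDensity X).ord.ToType := fun y =>
    {t | (t.toOrd : Ordinal) < (localDensityAt y).ord}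
  have hAcard : ∀ y, #(A y) ≤ localDensityAt y := fun y => by
    rw [← Cardinal.mk_ord_toType (localDensityAt y)]
    refine Cardinal.mk_le_of_injective
      (f := fun t : A y => Ordinal.ToType.mk ⟨(t.1.toOrd : Ordinal), t.2⟩) fun s t hst => ?_
    have := Subtype.ext_iff.1 (Ordinal.ToType.mk.injective hst)
    exact Subtype.ext (Ordinal.ToType.mk.symm.injective (Subtype.ext this))
  refine compacts_cofinallyBelow_of_codedNear (R := R) (A := A) (δ := ε / 4) (by positivity)
    (fun y hy z hz hyz => ?_) (fun y hy => ?_) fun f => ?_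
  · by_contra! h
    have hd : dist y z < ε := by linarith
    refine hyz (hR.injOn hy hz (le_antisymm ?_ ?_))
    · exact hYloc z (hRZ hz).1 y hd
    · exact hYloc y (hRZ hy).1 z (dist_comm y z ▸ hd)
  · refine codedNear_of_mk_le_density (fun U hU hUc => ?_) fun U hU =>
      (hAcard y).trans (localDensityAt_le hU)
    exact ((hRZ hy).2.trans_le (localDensityAt_le hU)).not_ge (density_le_aleph0_of_isCompact hUc)
  · let ι := Σ n, f n
    let o : ι → Ordinal := fun i => i.2.1.toOrd
    have hbound : ⨆ i, o i < (localDensity X).ord := by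
      refine Ordinal.iSup_lt_of_lt_cof (lt_of_le_of_lt ?_ hcof) fun i => i.2.1.toOrd.2
      exact Cardinal.mk_le_aleph0
    obtain ⟨x, hxY, hx⟩ := hY (max ℵ₀ (⨆ i, o i).card) (max_lt hκ (Cardinal.lt_ord.1 hbound))
    obtain ⟨y, hyR, hyx⟩ := hR.surjOn
      (mem_image_of_mem localDensityAt (show x ∈ Z from ⟨hxY, (le_max_left _ _).trans_lt hx⟩))
    refine ⟨y, hyR, fun n t ht => ?_⟩
    have hsup : ⨆ i, o i < (localDensityAt y).ord :=
      Cardinal.lt_ord.2 (hyx ▸ (le_max_right _ _).trans_lt hx)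
    exact (le_ciSup (Ordinal.bddAbove_of_small) (⟨n, t, ht⟩ : ι)).trans_lt hsup

lemma compacts_cofinallyBelow_of_localDensity [CompleteSpace X] (hX : ¬ LocallyCompactSpace X)
    (hld : LocalDensityRealized X ∨ ℵ₀ < (localDensity X).ord.cof) :
    CofinallyBelow (Compacts X) (ℕ → FinSubsets (localDensity X)) := by
  -- In the countable case any point without compact neighborhoods works, whether or not it realizes
  -- the local density.
  rcases le_or_gt (localDensity X) ℵ₀ with hκ | hκ
  · have : ∃ x : X, ∀ U ∈ 𝓝 x, ¬ IsCompact U := by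
      by_contra! h
      have : WeaklyLocallyCompactSpace X := ⟨fun x => (h x).imp fun U hU => ⟨hU.2, hU.1⟩⟩
      exact hX inferInstance
    obtain ⟨x, hx⟩ := this
    refine compacts_cofinallyBelow_of_codedNear_univ (codedNear_of_mk_le_density hx fun U hU => ?_)
    rw [Cardinal.mk_univ, Cardinal.mk_ord_toType]
    exact hκ.trans (aleph0_le_density_of_not_isCompact (hx U hU))
  rcases hld with ⟨x, hx⟩ | hcof
  · have hle : ∀ U ∈ 𝓝 x, localDensity X ≤ density U := fun U hU => hx ▸ localDensityAt_le hU
    refine compacts_cofinallyBelow_of_codedNear_univ (codedNear_of_mk_le_density (x := x)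
      (fun U hU hUc => ?_) fun U hU => ?_)
    · exact (hκ.trans_le (hle U hU)).not_ge (density_le_aleph0_of_isCompact hUc)
    · rw [Cardinal.mk_univ, Cardinal.mk_ord_toType]
      exact hle U hU
  · exact compacts_cofinallyBelow_of_lt_cof hcof

end Cofinality

end CofinalStructure

theorem mainTheorem11 {X : Type*} [MetricSpace X] [CompleteSpace X]
    (hX : ¬ LocallyCompactSpace X)
    (hd : CofinalStructure.density X = CofinalStructure.localDensity X)
    (hld : CofinalStructure.LocalDensityRealized X ∨
      Cardinal.aleph0 < (CofinalStructure.localDensity X).ord.cof) :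
    CofinalStructure.CofinallyEquiv (TopologicalSpace.Compacts X)
      (ℕ → CofinalStructure.FinSubsets (CofinalStructure.density X)) := by
  constructor
  · rw [hd]
    exact CofinalStructure.compacts_cofinallyBelow_of_localDensity hX hld
  · obtain ⟨D, hD, hcard⟩ := CofinalStructure.exists_dense_mk_eq_density X
    obtain ⟨e⟩ := Cardinal.eq.1 ((Cardinal.mk_ord_toType _).trans hcard.symm)
    refine CofinalStructure.finsets_cofinallyBelow_compacts (d := fun t => (e t : X)) ?_
    rw [DenseRange, Set.range_comp' Subtype.val e, e.surjective.range_eq]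
    simpa using hD
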